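/- Let $k$ be a number field. For $n\in k[t]$ write $|n|=\deg n$; call a nonzero $n$ positive ($n\succ 0$) if the leading coefficient of $(-1)^{|n|}n$ is a nonzero square in $k$, and negative if $-n$ is positive. Let $D\in k[t]$ be square-free and negative with $|D|$ odd. Let $\mathcal Q_D$ be the set of binary quadratic forms $Q=(a,b,c)$, $Q(x,y)=ax^2+2bxy+cy^2$ with $a,b,c\in k[t]$, $b^2-ac=D$ and $a\succ 0$. Identify $Q$ with its symmetric matrix $\left(\begin{smallmatrix}a&b\\b&c\end{smallmatrix}\right)$ and let $M$ act by $Q|M=MQM^{t}$. Let $\mathcal C_D$ be the group of $\mathrm{SL}_2(k[t])$-classes of forms in $\mathcal Q_D$ under composition: if $C$ and $C'$ contain concordant forms $(a,e,a'f)$ and $(a',e,af)$, where concordant means $\gcd(a,a',2e)=1$, then $C\otimes C'$ is the class of $(aa',e,f)$. For a prime (monic irreducible) $p\in k[t]$ put $F_p=k[t]/(p)$. For nonzero $g,h\in k[t]$ with $g=p^{v_p(g)}u_g$, $h=p^{v_p(h)}u_h$ and $u_g,u_h$ prime to $p$, let $$(g,h)_p=(-1)^{v_p(g)v_p(h)}\,\bar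 u_g^{\,v_p(h)}\,\bar u_h^{\,v_p(g)}\in F_p^{\times}/F_p^{\times 2}.$$ For $p\mid D$ and $Q\in\mathcal Q_D$ let $\chi_p(Q)=(n,D)_p$, where $n$ is any polynomial prime to $p$ that is properly represented by $Q$, i.e. $n=Q(x,y)$ with $x,y\in k[t]$ coprime; this depends only on the class of $Q$. The principal genus is the set of classes in $\mathcal C_D$ on which $\chi_p=1$ for all primes $p\mid D$, and the genera are the cosets of the principal genus in $\mathcal C_D$. Two forms are in the same genus if their classes lie in the same coset. Then two forms $Q,Q'\in\mathcal Q_D$ are in the same genus if and only if they are rationally equivalent, that is, $Q'=MQM^{t}$ for some $M\in\mathrm{GL}_2(k(t))$. -/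

import Mathlib

open Polynomial

namespace PolyForm

noncomputable section

/-- The binary quadratic form `(a, b, c) = a x ^ 2 + 2 b x y + c y ^ 2`. -/
@[ext]
structure BinForm (R : Type*) where
  a : R
  b : R
  c : R

namespace BinForm

variable {R : Type*} [CommRing R]

/-- The value `Q(x, y)`. -/
def eval (Q : BinForm R) (x y : R) : R :=
  Q.a * x ^ 2 + 2 * Q.b * x * y + Q.c * y ^ 2

/-- The discriminant (Gaussian determinant) `b ^ 2 - a c`. -/
def disc (Q : BinForm R) : R := Q.b ^ 2 - Q.a * Q.c

/-- The symmetric matrix of a form. -/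
def toMatrix (Q : BinForm R) : Matrix (Fin 2) (Fin 2) R := !![Q.a, Q.b; Q.b, Q.c]

/-- `n` is properly represented by `Q`: `n = Q(x, y)` with `x`, `y` coprime. -/
def ProperlyRepresents (Q : BinForm R) (n : R) : Prop :=
  ∃ x y : R, IsCoprime x y ∧ Q.eval x y = n

/-- `Q'` is `M Q Mᵗ` for some `M` in `SL₂(R)`. -/
def SLEquiv (Q Q' : BinForm R) : Prop :=
  ∃ M : Matrix.SpecialLinearGroup (Fin 2) R,
    Q'.toMatrix = (M : Matrix (Fin 2) (Fin 2) R) * Q.toMatrix *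
      (M : Matrix (Fin 2) (Fin 2) R).transpose

theorem SLEquiv.refl (Q : BinForm R) : SLEquiv Q Q := ⟨1, by simp⟩

theorem SLEquiv.symm {Q Q' : BinForm R} (h : SLEquiv Q Q') : SLEquiv Q' Q := by
  obtain ⟨M, hM⟩ := h
  refine ⟨M⁻¹, ?_⟩
  have h1 : ((M⁻¹ : Matrix.SpecialLinearGroup (Fin 2) R) : Matrix (Fin 2) (Fin 2) R) *
      (M : Matrix (Fin 2) (Fin 2) R) = 1 := by
    rw [← Matrix.SpecialLinearGroup.coe_mul, inv_mul_cancel,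
      Matrix.SpecialLinearGroup.coe_one]
  have h2 := congrArg Matrix.transpose h1
  rw [Matrix.transpose_mul, Matrix.transpose_one] at h2
  rw [hM]
  simp only [Matrix.mul_assoc]
  rw [h2, Matrix.mul_one, ← Matrix.mul_assoc, h1, Matrix.one_mul]

theorem SLEquiv.trans {Q Q' Q'' : BinForm R} (h : SLEquiv Q Q') (h' : SLEquiv Q' Q'') :
    SLEquiv Q Q'' := by
  obtain ⟨M, hM⟩ := h
  obtain ⟨N, hN⟩ := h'
  refine ⟨N * M, ?_⟩
  rw [hN, hM, Matrix.SpecialLinearGroup.coe_mul, Matrix.transpose_mul]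
  simp only [Matrix.mul_assoc]

theorem SLEquiv.properlyRepresents {Q Q' : BinForm R} (h : SLEquiv Q Q') {n : R}
    (hn : Q'.ProperlyRepresents n) : Q.ProperlyRepresents n := by
  obtain ⟨M, hM⟩ := h
  obtain ⟨x, y, ⟨u, v, huv⟩, rfl⟩ := hn
  have hdet := M.det_coe
  rw [Matrix.det_fin_two] at hdet
  set m := (M : Matrix (Fin 2) (Fin 2) R) 0 0 with hm
  set r := (M : Matrix (Fin 2) (Fin 2) R) 0 1 with hr
  set s := (M : Matrix (Fin 2) (Fin 2) R) 1 0 with hs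
  set w := (M : Matrix (Fin 2) (Fin 2) R) 1 1 with hw
  have ha := congrFun (congrFun hM 0) 0
  have hb := congrFun (congrFun hM 0) 1
  have hc := congrFun (congrFun hM 1) 1
  simp only [toMatrix, Matrix.mul_apply, Fin.sum_univ_two, Matrix.transpose_apply,
    Matrix.of_apply, Matrix.cons_val', Matrix.cons_val_zero, Matrix.cons_val_one,
    Matrix.cons_val_fin_one, ← hm, ← hr, ← hs, ← hw] at ha hb hc
  refine ⟨m * x + s * y, r * x + w * y, ⟨u * w - v * r, v * m - u * s, ?_⟩, ?_⟩
  · linear_combination (u * x + v * y) * hdet + huv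
  · simp only [eval]
    rw [ha, hb, hc]
    ring

end BinForm

variable {k : Type*} [Field k]

/-- `n ≻ 0`: the leading coefficient of `(-1) ^ deg n * n` is a nonzero square of `k`. -/
def IsPositive (n : k[X]) : Prop :=
  ∃ α : k, α ≠ 0 ∧ ((-1) ^ n.natDegree * n).leadingCoeff = α ^ 2

/-- `n ≺ 0`: `-n` is positive. -/
def IsNegative (n : k[X]) : Prop := IsPositive (-n)

/-- The forms `(a, b, c)` over `k[t]` with discriminant `D` and `a ≻ 0`. -/
def FormsOfDisc (D : k[X]) : Set (BinForm k[X]) :=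
  {Q | Q.disc = D ∧ IsPositive Q.a}

/-- `SL₂(k[t])`-equivalence on the forms of discriminant `D`. -/
instance formSetoid (D : k[X]) : Setoid (FormsOfDisc D) where
  r Q Q' := BinForm.SLEquiv Q.1 Q'.1
  iseqv := ⟨fun Q => BinForm.SLEquiv.refl Q.1, fun h => h.symm, fun h h' => h.trans h'⟩

/-- The set `C_D` of `SL₂(k[t])`-classes of forms of discriminant `D`. -/
def FormClass (D : k[X]) : Type _ := Quotient (formSetoid D)

/-- The class of a form. -/
def FormClass.mk {D : k[X]} (Q : FormsOfDisc D) : FormClass D := Quotient.mk (formSetoid D) Q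

/-- Two forms are concordant if `gcd (a, a', b + b') = 1`. -/
def Concordant (Q Q' : BinForm k[X]) : Prop :=
  ∀ d : k[X], d ∣ Q.a → d ∣ Q'.a → d ∣ Q.b + Q'.b → IsUnit d

/-- The graph of the composition law of `C_D`: `C ⊗ C' = C''`. This holds when `C` and `C'`
contain concordant forms `(a, e, a' f)` and `(a', e, a f)` and `C''` is the class of
`(a a', e, f)`. -/
def IsComposition {D : k[X]} (C C' C'' : FormClass D) : Prop :=
  ∃ (a a' e f : k[X])
    (h : (⟨a, e, a' * f⟩ : BinForm k[X]) ∈ FormsOfDisc D)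
    (h' : (⟨a', e, a * f⟩ : BinForm k[X]) ∈ FormsOfDisc D)
    (h'' : (⟨a * a', e, f⟩ : BinForm k[X]) ∈ FormsOfDisc D),
    Concordant ⟨a, e, a' * f⟩ ⟨a', e, a * f⟩ ∧
    FormClass.mk ⟨_, h⟩ = C ∧ FormClass.mk ⟨_, h'⟩ = C' ∧ FormClass.mk ⟨_, h''⟩ = C''

/-- The group `F_pˣ / F_pˣ²`, where `F_p = k[t] / (p)`. -/
abbrev SquareClass (p : k[X]) : Type _ :=
  (AdjoinRoot p)ˣ ⧸ (powMonoidHom 2 : (AdjoinRoot p)ˣ →* (AdjoinRoot p)ˣ).range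

/-- The image in `F_pˣ` of `u`, where `a = p ^ v u` with `v = v_p(a)` (junk value `1` if
`a = 0`). -/
def residueUnit (p a : k[X]) : (AdjoinRoot p)ˣ :=
  open Classical in
  if h : IsUnit (AdjoinRoot.mk p (a / p ^ multiplicity p a)) then h.unit else 1

/-- The symbol `(a, b)_p` of nonzero polynomials at a prime `p`: the class of
`(-1) ^ (v(a) v(b)) * u_a ^ v(b) * u_b ^ v(a)`, where `a = p ^ v(a) u_a`, `b = p ^ v(b) u_b`. -/
def tameSymbol (p a b : k[X]) : SquareClass p :=
  QuotientGroup.mk ((-1) ^ (multiplicity p a * multiplicity p b) *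
    residueUnit p a ^ multiplicity p b * residueUnit p b ^ multiplicity p a)

/-- `χ_p(Q) = (n, D)_p`, where `n` is some polynomial prime to `p` that is properly
represented by `Q`. See `exists_properlyRepresents` and `genusChar_eq` for the existence of
`n` and the independence of the choice. -/
def genusChar {D : k[X]} (p : k[X]) (Q : FormsOfDisc D) : SquareClass p :=
  tameSymbol p (Classical.epsilon fun n => IsCoprime n p ∧ Q.1.ProperlyRepresents n) D

theorem exists_properlyRepresents [CharZero k] {D p : k[X]} (hD : Squarefree D)
    (hp : Irreducible p) (Q : FormsOfDisc D) :
    ∃ n, IsCoprime n p ∧ Q.1.ProperlyRepresents n := by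
  obtain ⟨⟨a, b, c⟩, hdisc, -⟩ := Q
  simp only [BinForm.disc] at hdisc
  have key : ∀ n : k[X], ¬ p ∣ n → IsCoprime n p := fun n hn =>
    ((Irreducible.coprime_iff_not_dvd hp).2 hn).symm
  by_cases ha : p ∣ a
  · by_cases hc : p ∣ c
    · refine ⟨a * 1 ^ 2 + 2 * b * 1 * 1 + c * 1 ^ 2, key _ ?_, 1, 1, isCoprime_one_left, rfl⟩
      intro h
      have h2 : p ∣ 2 * b := by
        have := dvd_sub (dvd_sub h ha) hc
        ring_nf at this
        rwa [mul_comm] at this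
      have hu : IsUnit (2 : k[X]) := by
        have : (2 : k[X]) = C 2 := rfl
        rw [this, isUnit_C]
        exact isUnit_iff_ne_zero.2 two_ne_zero
      have hb : p ∣ b := by
        rcases hp.prime.dvd_or_dvd h2 with h3 | h3
        · exact absurd (isUnit_of_dvd_unit h3 hu) hp.not_isUnit
        · exact h3
      refine hp.not_isUnit (hD p ?_)
      rw [← hdisc, pow_two]
      exact dvd_sub (mul_dvd_mul hb hb) (mul_dvd_mul ha hc)
    · exact ⟨c, key _ hc, 0, 1, isCoprime_one_right, by simp [BinForm.eval]⟩
  · exact ⟨a, key _ ha, 1, 0, isCoprime_one_left, by simp [BinForm.eval]⟩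

theorem tameSymbol_eq {D p n : k[X]} (hD : Squarefree D) (hp : Irreducible p) (hpD : p ∣ D)
    (hn : IsCoprime n p) :
    ∃ h : IsUnit (AdjoinRoot.mk p n), tameSymbol p n D = QuotientGroup.mk h.unit := by
  have hu : IsUnit (AdjoinRoot.mk p n) := by
    obtain ⟨x, y, hxy⟩ := hn
    have := congrArg (AdjoinRoot.mk p) hxy
    simp only [map_add, map_mul, AdjoinRoot.mk_self, mul_zero, add_zero, map_one] at this
    exact IsUnit.of_mul_eq_one _ (by rw [mul_comm]; exact this)
  refine ⟨hu, ?_⟩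
  have hpn : ¬ p ∣ n := (Irreducible.coprime_iff_not_dvd hp).1 hn.symm
  have h0 : multiplicity p n = 0 := multiplicity_eq_zero.2 hpn
  have h1 : multiplicity p D = 1 := by
    apply multiplicity_eq_of_dvd_of_not_dvd
    · simpa using hpD
    · intro h
      rw [pow_two] at h
      exact hp.not_isUnit (hD p h)
  have hr : residueUnit p n = hu.unit := by
    unfold residueUnit
    have e : n / p ^ multiplicity p n = n := by simp [h0]
    rw [e, dif_pos hu]
  simp [tameSymbol, h0, h1, hr]

/-- The value of `χ_p` at a prime `p ∣ D` does not depend on the choice of `n`. -/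
theorem genusChar_eq [CharZero k] {D p n : k[X]} (hD : Squarefree D) (hp : Irreducible p)
    (hpD : p ∣ D) (Q : FormsOfDisc D) (hn : IsCoprime n p)
    (hQ : Q.1.ProperlyRepresents n) : genusChar p Q = tameSymbol p n D := by
  obtain ⟨hn', hQ'⟩ := Classical.epsilon_spec (exists_properlyRepresents hD hp Q)
  unfold genusChar
  set n' := Classical.epsilon fun n => IsCoprime n p ∧ Q.1.ProperlyRepresents n
  obtain ⟨h, e⟩ := tameSymbol_eq hD hp hpD hn
  obtain ⟨h', e'⟩ := tameSymbol_eq hD hp hpD hn'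
  rw [e, e', QuotientGroup.eq]
  clear_value n'
  obtain ⟨x, y, -, hv⟩ := hQ
  obtain ⟨x', y', -, hv'⟩ := hQ'
  have hdisc : Q.1.b ^ 2 - Q.1.a * Q.1.c = D := Q.2.1
  set z := Q.1.a * x * x' + Q.1.b * (x * y' + x' * y) + Q.1.c * y * y' with hz
  have hD0 : AdjoinRoot.mk p D = 0 := AdjoinRoot.mk_eq_zero.2 hpD
  have hprod : AdjoinRoot.mk p n * AdjoinRoot.mk p n' = AdjoinRoot.mk p z ^ 2 := by
    have e1 : n * n' = z ^ 2 - D * (x * y' - x' * y) ^ 2 := by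
      rw [← hv, ← hv', hz]
      simp only [BinForm.eval]
      linear_combination -(x * y' - x' * y) ^ 2 * hdisc
    rw [← map_mul, e1, map_sub, map_mul, hD0, map_pow]
    ring
  have hzu : IsUnit (AdjoinRoot.mk p z) := by
    rw [← isUnit_pow_iff two_ne_zero, ← hprod]
    exact h.mul h'
  have hsq : h'.unit * h.unit = hzu.unit ^ 2 := by
    ext
    simpa [mul_comm] using hprod
  refine ⟨h'.unit⁻¹ * hzu.unit, ?_⟩
  rw [powMonoidHom_apply, mul_pow, ← hsq, pow_two, mul_assoc, inv_mul_cancel_left]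

/-- `χ_p` as a function on classes. -/
def classChar {D : k[X]} (p : k[X]) (C : FormClass D) : SquareClass p :=
  Quotient.lift (genusChar p) (by
    intro Q Q' h
    have h' : BinForm.SLEquiv Q.1 Q'.1 := h
    have : (fun n => IsCoprime n p ∧ Q.1.ProperlyRepresents n) =
        fun n => IsCoprime n p ∧ Q'.1.ProperlyRepresents n := by
      funext n
      exact propext (and_congr_right fun _ =>
        ⟨h'.symm.properlyRepresents, h'.properlyRepresents⟩)
    unfold genusChar
    rw [this]) C

/-- The principal genus: the classes killed by all `χ_p` with `p` a prime (monic irreducible)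
divisor of `D`. -/
def principalGenus (D : k[X]) : Set (FormClass D) :=
  {C | ∀ p : k[X], p.Monic → Irreducible p → p ∣ D → classChar p C = 1}

/-- The genera: the cosets `C ⊗ H` of the principal genus `H` in `C_D`. -/
def genera (D : k[X]) : Set (Set (FormClass D)) :=
  {G | ∃ C : FormClass D, G = {C' | ∃ P ∈ principalGenus D, IsComposition C P C'}}

/-- Two forms are in the same genus if one genus contains the classes of both. -/
def SameGenus {D : k[X]} (Q Q' : FormsOfDisc D) : Prop :=
  ∃ G ∈ genera D, FormClass.mk Q ∈ G ∧ FormClass.mk Q' ∈ G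

/-- Rational equivalence: `Q' = M Q Mᵗ` for some `M` in `GL₂(k(t))`. -/
def RationallyEquiv (Q Q' : BinForm k[X]) : Prop :=
  ∃ M : Matrix.GeneralLinearGroup (Fin 2) (RatFunc k),
    Q'.toMatrix.map (algebraMap k[X] (RatFunc k)) =
      (M : Matrix (Fin 2) (Fin 2) (RatFunc k)) *
        Q.toMatrix.map (algebraMap k[X] (RatFunc k)) *
        (M : Matrix (Fin 2) (Fin 2) (RatFunc k)).transpose

end

end PolyForm

namespace PolyForm

/-! ### Changes of basis and the identities expressing products of values as norms. -/

namespace BinForm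

variable {R : Type*} [CommRing R]

/-! Both relations turn out to say that `χ_p(Q) = χ_p(Q')` for every prime `p ∣ D`.

Genus and characters: Gauss's bilinear identity makes each `χ_p` multiplicative under composition
(`classChar_mul`), so the characters are constant on a coset of the principal genus. Conversely, any
class is `[Q] ⊗ P` for some `P` (`exists_isComposition`), and equal characters force `P` into the
principal genus.

Rational equivalence and characters: two values of `Q` over `k(t)` multiply to a norm from
`k(t)(√D)`. A norm that is prime to `p` up to squares is a square modulo a ramified `p`
(`exists_dvd_sub_sq_of_norm`), so `χ_p` depends only on the values over `k(t)`. Conversely, choose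
representatives `(a, e, a'f)` and `(a', e, af)` with `a`, `a'` prime to `D`. Equal characters make
`aa'` a square modulo `D`, while `e² - D = aa'f` makes `D` a square modulo `aa'`. Legendre's theorem
(`exists_norm_eq`) then makes `aa'` a norm, so the first form represents `a'` over `k(t)`. With
equal discriminants this gives equivalence.

Odd `|D|` and negativity of `D` make all nonzero norms positive, so no change of basis leaves the
set of forms considered. Odd `|D|` also makes the dimension count in Legendre's theorem succeed. -/

theorem SLEquiv.of_entries {Q Q' : BinForm R} (x y z w : R) (hdet : x * w - y * z = 1)
    (ha : Q'.a = Q.eval x y) (hb : Q'.b = Q.a * x * z + Q.b * (x * w + y * z) + Q.c * y * w)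
    (hc : Q'.c = Q.eval z w) : SLEquiv Q Q' := by
  refine ⟨⟨!![x, y; z, w], by rw [Matrix.det_fin_two_of]; exact hdet⟩, ?_⟩
  ext i j
  fin_cases i <;> fin_cases j <;>
    simp [toMatrix, Matrix.mul_apply, Fin.sum_univ_two, ha, hb, hc, eval] <;> ring

/-- Translating the first variable. -/
theorem SLEquiv.translate (Q : BinForm R) (s : R) :
    SLEquiv Q ⟨Q.a, Q.b + Q.a * s, Q.c + 2 * Q.b * s + Q.a * s ^ 2⟩ :=
  SLEquiv.of_entries 1 0 s 1 (by ring) (by simp [eval]) (by simp; ring) (by simp [eval]; ring)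

theorem SLEquiv.disc_eq {Q Q' : BinForm R} (h : SLEquiv Q Q') : Q'.disc = Q.disc := by
  obtain ⟨M, hM⟩ := h
  have h1 := congrArg Matrix.det hM
  simp only [Matrix.det_mul, Matrix.det_transpose, M.det_coe, toMatrix,
    Matrix.det_fin_two_of] at h1
  simp only [disc]
  linear_combination -h1

/-- The product of two values of a form is a norm. -/
theorem eval_mul_eval (Q : BinForm R) (x y x' y' : R) :
    Q.eval x y * Q.eval x' y' =
      (Q.a * x * x' + Q.b * (x * y' + x' * y) + Q.c * y * y') ^ 2 -
        Q.disc * (x * y' - x' * y) ^ 2 := by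
  simp only [eval, disc]
  ring

theorem a_mul_eval (Q : BinForm R) (x y : R) :
    Q.a * Q.eval x y = (Q.a * x + Q.b * y) ^ 2 - Q.disc * y ^ 2 := by
  simp only [eval, disc]
  ring

end BinForm

variable {k : Type*} [Field k]

/-! ### Characters -/

theorem isCoprime_of_not_dvd {p n : k[X]} (hp : Irreducible p) (h : ¬ p ∣ n) : IsCoprime n p :=
  ((Irreducible.coprime_iff_not_dvd hp).2 h).symm

/-- Since `v_p(D) = 1` and `v_p(n) = 0`, the symbol is just the square class of `n` modulo `p`. -/
theorem tameSymbol_eq_iff {D p n n' : k[X]} (hD : Squarefree D) (hp : Irreducible p)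
    (hpD : p ∣ D) (hn : IsCoprime n p) (hn' : IsCoprime n' p) :
    tameSymbol p n D = tameSymbol p n' D ↔ ∃ s, p ∣ n * n' - s ^ 2 := by
  obtain ⟨h, e⟩ := tameSymbol_eq hD hp hpD hn
  obtain ⟨h', e'⟩ := tameSymbol_eq hD hp hpD hn'
  rw [e, e', QuotientGroup.eq]
  constructor
  · rintro ⟨z, hz⟩
    obtain ⟨q, hq⟩ := AdjoinRoot.mk_surjective (z : AdjoinRoot p)
    refine ⟨n * q, ?_⟩
    rw [← AdjoinRoot.mk_eq_zero, map_sub, map_mul, map_pow, map_mul, hq, sub_eq_zero]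
    have h1 : h'.unit = h.unit * z ^ 2 := by
      rw [powMonoidHom_apply] at hz
      rw [hz, mul_inv_cancel_left]
    have h2 := congrArg Units.val h1
    simp only [IsUnit.unit_spec, Units.val_mul, Units.val_pow_eq_pow_val] at h2
    rw [h2]
    ring
  · rintro ⟨s, hs⟩
    have hprod : AdjoinRoot.mk p n * AdjoinRoot.mk p n' = AdjoinRoot.mk p s ^ 2 := by
      rw [← AdjoinRoot.mk_eq_zero, map_sub, map_mul, map_pow, sub_eq_zero] at hs
      exact hs
    have hzu : IsUnit (AdjoinRoot.mk p s) := by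
      rw [← isUnit_pow_iff two_ne_zero, ← hprod]
      exact h.mul h'
    have hsq : h.unit * h'.unit = hzu.unit ^ 2 := by
      ext
      simpa using hprod
    refine ⟨h.unit⁻¹ * hzu.unit, ?_⟩
    rw [powMonoidHom_apply, mul_pow, ← hsq, pow_two, mul_assoc, inv_mul_cancel_left]

theorem tameSymbol_mul {D p n n' : k[X]} (hD : Squarefree D) (hp : Irreducible p)
    (hpD : p ∣ D) (hn : IsCoprime n p) (hn' : IsCoprime n' p) :
    tameSymbol p (n * n') D = tameSymbol p n D * tameSymbol p n' D := by
  obtain ⟨h, e⟩ := tameSymbol_eq hD hp hpD hn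
  obtain ⟨h', e'⟩ := tameSymbol_eq hD hp hpD hn'
  obtain ⟨h'', e''⟩ := tameSymbol_eq hD hp hpD (hn.mul_left hn')
  rw [e, e', e'', ← QuotientGroup.mk_mul]
  congr 1
  ext
  simp

/-- A unit at `p` that is a norm times a square is a square modulo a ramified prime `p`. -/
theorem exists_dvd_sub_sq_of_norm {D p u : k[X]} (hD : Squarefree D) (hp : Irreducible p)
    (hpD : p ∣ D) (d z w : k[X]) (hd : d ≠ 0) (h : u * d ^ 2 = z ^ 2 - D * w ^ 2) :
    ∃ s, p ∣ u - s ^ 2 := by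
  -- Descent on `deg d`. If `p ∣ d`, then `p ∣ z`, so `p² ∣ D w²`; as `D` is square-free, `p ∣ w`,
  -- and `p²` cancels. If `p ∤ d`, invert `d` modulo `p`: since `p ∣ D`, the square root is `z / d`.
  induction hN : d.natDegree using Nat.strong_induction_on generalizing d z w with
  | _ N ih =>
    by_cases hpd : p ∣ d
    · obtain ⟨d, rfl⟩ := hpd
      have hz : p ∣ z := by
        refine hp.prime.dvd_of_dvd_pow (n := 2) ?_
        have : z ^ 2 = u * (p * d) ^ 2 + D * w ^ 2 := by rw [h]; ring
        rw [this]
        exact dvd_add (Dvd.intro (u * p * d ^ 2) (by ring)) (hpD.mul_right _)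
      obtain ⟨z, rfl⟩ := hz
      have hw : p ∣ w := by
        by_contra hw
        have h1 : p * p ∣ D * w ^ 2 := ⟨z ^ 2 - u * d ^ 2, by linear_combination h⟩
        have h2 : IsCoprime (p * p) (w ^ 2) := by
          have := isCoprime_of_not_dvd hp hw
          exact (this.symm.mul_left this.symm).pow_right
        exact hp.not_isUnit (hD p (h2.dvd_of_dvd_mul_right h1))
      obtain ⟨w, rfl⟩ := hw
      have hd0 : d ≠ 0 := right_ne_zero_of_mul hd
      refine ih d.natDegree ?_ d z w hd0 ?_ rfl
      · rw [← hN, natDegree_mul hp.ne_zero hd0]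
        have := hp.natDegree_pos
        omega
      · refine mul_left_cancel₀ (pow_ne_zero 2 hp.ne_zero) ?_
        linear_combination h
    · obtain ⟨v, v', hv⟩ := isCoprime_of_not_dvd hp hpd
      obtain ⟨D', rfl⟩ := hpD
      refine ⟨z * v, u * v' * (1 + v * d) - D' * w ^ 2 * v ^ 2, ?_⟩
      linear_combination v ^ 2 * h - u * (1 + v * d) * hv

/-- `χ_p(Q)` can be computed from any value prime to `p` that `Q` takes over `k(t)`. -/
theorem genusChar_eq_of_eval [CharZero k] {D p n d x y : k[X]} (hD : Squarefree D)
    (hp : Irreducible p) (hpD : p ∣ D) (Q : FormsOfDisc D) (hn : IsCoprime n p) (hd : d ≠ 0)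
    (h : Q.1.eval x y = n * d ^ 2) : genusChar p Q = tameSymbol p n D := by
  obtain ⟨n', hn', x', y', hc, hxy⟩ := exists_properlyRepresents hD hp Q
  rw [genusChar_eq hD hp hpD Q hn' ⟨x', y', hc, hxy⟩, tameSymbol_eq_iff hD hp hpD hn' hn]
  have hdisc : Q.1.disc = D := Q.2.1
  have := Q.1.eval_mul_eval x' y' x y
  rw [hxy, h, hdisc] at this
  exact exists_dvd_sub_sq_of_norm hD hp hpD d _ _ hd (by rw [mul_assoc]; exact this)

/-- Gauss's composition identity writes the product of values of the two forms as a value of the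
composite. That value need not be proper, which `genusChar_eq_of_eval` permits. -/
theorem classChar_mul [CharZero k] {D p : k[X]} (hD : Squarefree D) (hp : Irreducible p)
    (hpD : p ∣ D) {C C' C'' : FormClass D} (h : IsComposition C C' C'') :
    classChar p C'' = classChar p C * classChar p C' := by
  obtain ⟨a, a', e, f, h, h', h'', -, rfl, rfl, rfl⟩ := h
  change genusChar p ⟨_, h''⟩ = genusChar p ⟨_, h⟩ * genusChar p ⟨_, h'⟩
  obtain ⟨n, hn, x, y, -, hxy⟩ := exists_properlyRepresents hD hp ⟨_, h⟩
  obtain ⟨n', hn', z, w, -, hzw⟩ := exists_properlyRepresents hD hp ⟨_, h'⟩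
  rw [genusChar_eq_of_eval hD hp hpD ⟨_, h⟩ hn one_ne_zero (by rw [hxy]; ring),
    genusChar_eq_of_eval hD hp hpD ⟨_, h'⟩ hn' one_ne_zero (by rw [hzw]; ring),
    ← tameSymbol_mul hD hp hpD hn hn']
  -- Gauss's bilinear substitution, from multiplying `ax + (e + √D)y` and `a'z + (e + √D)w`, using
  -- `(e + √D)² = 2e(e + √D) - aa'f`.
  refine genusChar_eq_of_eval (x := x * z - f * y * w) (y := a * x * w + a' * y * z + 2 * e * y * w)
    hD hp hpD ⟨_, h''⟩ (hn.mul_left hn') one_ne_zero ?_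
  rw [← hxy, ← hzw]
  simp only [BinForm.eval]
  ring

theorem SameGenus.genusChar_eq [CharZero k] {D : k[X]} (hD : Squarefree D)
    {Q Q' : FormsOfDisc D} (h : SameGenus Q Q') (p : k[X]) (hm : p.Monic) (hp : Irreducible p)
    (hpD : p ∣ D) : genusChar p Q = genusChar p Q' := by
  obtain ⟨G, ⟨C, rfl⟩, ⟨P, hP, hQ⟩, ⟨P', hP', hQ'⟩⟩ := h
  have h1 := classChar_mul hD hp hpD hQ
  have h2 := classChar_mul hD hp hpD hQ'
  rw [hP p hm hp hpD] at h1
  rw [hP' p hm hp hpD] at h2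
  exact h1.trans h2.symm

/-! ### Positivity -/

theorem isPositive_iff {n : k[X]} :
    IsPositive n ↔ ∃ α : k, α ≠ 0 ∧ n.leadingCoeff = (-1) ^ n.natDegree * α ^ 2 := by
  have h : ((-1) ^ n.natDegree * n).leadingCoeff = (-1) ^ n.natDegree * n.leadingCoeff := by
    rcases neg_one_pow_eq_or k[X] n.natDegree with h | h <;>
      rcases neg_one_pow_eq_or k n.natDegree with h' | h' <;>
      rcases Nat.even_or_odd n.natDegree with h'' | h'' <;>
      simp [h''.neg_one_pow]
  unfold IsPositive
  rw [h]
  have h1 : ((-1 : k) ^ n.natDegree) * (-1) ^ n.natDegree = 1 := by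
    rw [← mul_pow]; simp
  refine exists_congr fun α => and_congr_right fun _ => ⟨fun h => ?_, fun h => ?_⟩
  · rw [← h, ← mul_assoc, h1, one_mul]
  · rw [h, ← mul_assoc, h1, one_mul]

theorem IsPositive.ne_zero {n : k[X]} (h : IsPositive n) : n ≠ 0 := by
  rintro rfl
  obtain ⟨α, hα, h⟩ := h
  exact pow_ne_zero 2 hα (by simpa using h.symm)

theorem IsPositive.of_mul {a n : k[X]} (ha : IsPositive a) (h : IsPositive (a * n)) :
    IsPositive n := by
  have hn : n ≠ 0 := right_ne_zero_of_mul h.ne_zero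
  have ha0 := ha.ne_zero
  rw [isPositive_iff] at *
  obtain ⟨α, hα, ha⟩ := ha
  obtain ⟨β, hβ, h⟩ := h
  refine ⟨β / α, div_ne_zero hβ hα, ?_⟩
  rw [leadingCoeff_mul, natDegree_mul ha0 hn, ha, pow_add] at h
  have h1 : ((-1 : k) ^ a.natDegree) ≠ 0 := by simp
  field_simp
  refine mul_left_cancel₀ h1 ?_
  linear_combination h

theorem IsNegative.leadingCoeff_eq {D : k[X]} (h : IsNegative D) (hodd : Odd D.natDegree) :
    ∃ α : k, α ≠ 0 ∧ D.leadingCoeff = α ^ 2 := by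
  obtain ⟨α, hα, h⟩ := isPositive_iff.1 h
  refine ⟨α, hα, ?_⟩
  rw [natDegree_neg, leadingCoeff_neg, hodd.neg_one_pow] at h
  linear_combination -h

/-- The two degrees have opposite parity, so leading terms in `X² - DY²` never cancel. -/
theorem natDegree_sq_lt_or {D : k[X]} (hodd : Odd D.natDegree) {X Y : k[X]} (hX : X ≠ 0)
    (hY : Y ≠ 0) : (X ^ 2).degree < (D * Y ^ 2).degree ∨ (D * Y ^ 2).degree < (X ^ 2).degree := by
  have hD : D ≠ 0 := by rintro rfl; simp at hodd
  rw [← ne_iff_lt_or_gt, degree_eq_natDegree (pow_ne_zero 2 hX),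
    degree_eq_natDegree (mul_ne_zero hD (pow_ne_zero 2 hY)), natDegree_mul hD (pow_ne_zero 2 hY),
    natDegree_pow, natDegree_pow]
  intro h
  have h' : 2 * X.natDegree = D.natDegree + 2 * Y.natDegree := by exact_mod_cast h
  obtain ⟨m, hm⟩ := hodd
  omega

/-- Nonzero norms from `k(t)(√D)` are positive. -/
theorem isPositive_norm {D : k[X]} (hneg : IsNegative D) (hodd : Odd D.natDegree) {X Y : k[X]}
    (h : X ≠ 0 ∨ Y ≠ 0) : IsPositive (X ^ 2 - D * Y ^ 2) := by
  have hD : D ≠ 0 := by rintro rfl; simp at hodd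
  obtain ⟨α, hα, hlc⟩ := hneg.leadingCoeff_eq hodd
  have hsq : ∀ {Z : k[X]}, Z ≠ 0 → IsPositive (Z ^ 2) := fun {Z} hZ => isPositive_iff.2
    ⟨Z.leadingCoeff, leadingCoeff_ne_zero.2 hZ, by simp [natDegree_pow, leadingCoeff_pow]⟩
  have hneg' : ∀ {Z : k[X]}, Z ≠ 0 → IsPositive (-(D * Z ^ 2)) := fun {Z} hZ => isPositive_iff.2
    ⟨α * Z.leadingCoeff, mul_ne_zero hα (leadingCoeff_ne_zero.2 hZ), by
      rw [leadingCoeff_neg, natDegree_neg, natDegree_mul hD (pow_ne_zero 2 hZ), natDegree_pow,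
        pow_add, hodd.neg_one_pow, leadingCoeff_mul, leadingCoeff_pow, hlc,
        (even_two_mul Z.natDegree).neg_one_pow]
      ring⟩
  by_cases hX : X = 0
  · subst hX
    simpa using hneg' (h.resolve_left (by simp))
  by_cases hY : Y = 0
  · subst hY
    simpa using hsq hX
  -- The leading term is that of `X²` or of `-DY²`, and each of these is positive.
  rcases natDegree_sq_lt_or hodd hX hY with h1 | h1
  · have h2 := isPositive_iff.1 (hneg' hY)
    rw [isPositive_iff]
    have h3 : (X ^ 2).degree < (-(D * Y ^ 2)).degree := by rwa [degree_neg]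
    rw [sub_eq_add_neg, leadingCoeff_add_of_degree_lt h3, natDegree_add_eq_right_of_degree_lt h3]
    exact h2
  · have h2 := isPositive_iff.1 (hsq hX)
    rw [isPositive_iff]
    rw [leadingCoeff_sub_of_degree_lt h1, natDegree_sub_eq_left_of_natDegree_lt]
    · exact h2
    · exact natDegree_lt_natDegree (mul_ne_zero hD (pow_ne_zero 2 hY)) h1

/-- Multiplying the value by the positive `a` gives a nonzero norm. Hence a first coefficient
obtained by any change of basis is again positive. -/
theorem isPositive_eval {D : k[X]} (hneg : IsNegative D) (hodd : Odd D.natDegree)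
    (Q : FormsOfDisc D) {x y : k[X]} (h : x ≠ 0 ∨ y ≠ 0) : IsPositive (Q.1.eval x y) := by
  refine Q.2.2.of_mul ?_
  rw [BinForm.a_mul_eval, show Q.1.disc = D from Q.2.1]
  refine isPositive_norm hneg hodd ?_
  by_cases hy : y = 0
  · subst hy
    left
    simpa using ⟨Q.2.2.ne_zero, h.resolve_right (by simp)⟩
  · exact Or.inr hy

/-! ### Normalizing representatives -/

theorem isUnit_two [CharZero k] : IsUnit (2 : k[X]) := by
  have : (2 : k[X]) = C 2 := rfl
  rw [this, isUnit_C]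
  exact isUnit_iff_ne_zero.2 two_ne_zero

/-- Modulo `p`, `Q(1, l)` is a polynomial in `l` of degree at most 2 over `F_p`. It is nonzero, for
otherwise `p` would divide `a`, `b`, `c` and `p² ∣ D`. As `k` embeds in `F_p` and is infinite,
constants `l` suffice to avoid finitely many primes. -/
theorem finite_dvd_eval [CharZero k] {D p : k[X]} (hD : Squarefree D) (hp : Irreducible p)
    (Q : BinForm k[X]) (hQ : Q.disc = D) : {l : k | p ∣ Q.eval 1 (C l)}.Finite := by
  have : Fact (Irreducible p) := ⟨hp⟩
  set g : (AdjoinRoot p)[X] := C (AdjoinRoot.mk p Q.a) + C (AdjoinRoot.mk p (2 * Q.b)) * X +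
    C (AdjoinRoot.mk p Q.c) * X ^ 2 with hg
  have hg0 : g ≠ 0 := by
    intro h0
    have h1 : p ∣ Q.a := by
      rw [← AdjoinRoot.mk_eq_zero]
      simpa [hg, coeff_C, coeff_X, coeff_X_pow] using congrArg (fun q => coeff q 0) h0
    have h2 : p ∣ 2 * Q.b := by
      rw [← AdjoinRoot.mk_eq_zero]
      simpa [hg, coeff_C, coeff_X, coeff_X_pow, coeff_C_mul, -map_mul] using
        congrArg (fun q => coeff q 1) h0
    have h3 : p ∣ Q.c := by
      rw [← AdjoinRoot.mk_eq_zero]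
      simpa [hg, coeff_C, coeff_X, coeff_X_pow, coeff_C_mul, -map_mul] using
        congrArg (fun q => coeff q 2) h0
    have h4 : p ∣ Q.b := isUnit_two.dvd_mul_left.1 h2
    refine hp.not_isUnit (hD p ?_)
    rw [← hQ, BinForm.disc, pow_two]
    exact dvd_sub (mul_dvd_mul h4 h4) (mul_dvd_mul h1 h3)
  refine Set.Finite.subset (Set.Finite.preimage (f := AdjoinRoot.of p)
    (AdjoinRoot.of p).injective.injOn (g.rootSet_finite (AdjoinRoot p))) ?_
  intro l hl
  rw [Set.mem_preimage, mem_rootSet]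
  refine ⟨hg0, ?_⟩
  rw [Set.mem_ofPred_eq, ← AdjoinRoot.mk_eq_zero, BinForm.eval] at hl
  simp only [map_add, map_mul, map_pow, one_pow, mul_one, AdjoinRoot.mk_C] at hl
  simpa [hg] using hl

theorem finite_not_isCoprime_eval [CharZero k] {D : k[X]} (hD : Squarefree D)
    (Q : BinForm k[X]) (hQ : Q.disc = D) (N : k[X]) (hN : N ≠ 0) :
    {l : k | ¬ IsCoprime (Q.eval 1 (C l)) N}.Finite := by
  induction N using UniqueFactorizationMonoid.induction_on_prime with
  | h₁ => exact absurd rfl hN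
  | h₂ N hu =>
    convert Set.finite_empty
    ext l
    simpa using isCoprime_one_right.of_isCoprime_of_dvd_right hu.dvd
  | h₃ N p hN' hp ih =>
    refine ((ih hN').union (finite_dvd_eval hD hp.irreducible Q hQ)).subset ?_
    intro l hl
    by_contra h
    simp only [Set.mem_union, Set.mem_ofPred_eq, not_or, not_not] at h
    exact hl ((isCoprime_of_not_dvd hp.irreducible h.2).mul_right h.1)

/-- Every class contains a form whose first coefficient is prime to a given `N ≠ 0`. -/
theorem exists_slEquiv_isCoprime [CharZero k] {D : k[X]} (hneg : IsNegative D)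
    (hD : Squarefree D) (hodd : Odd D.natDegree) (Q : FormsOfDisc D) (N : k[X]) (hN : N ≠ 0) :
    ∃ Q' : FormsOfDisc D, BinForm.SLEquiv Q.1 Q'.1 ∧ IsCoprime Q'.1.a N := by
  obtain ⟨l, hl⟩ := (finite_not_isCoprime_eval hD Q.1 Q.2.1 N hN).exists_notMem
  have hl : IsCoprime (Q.1.eval 1 (C l)) N := by simpa using hl
  have hS : BinForm.SLEquiv Q.1 ⟨Q.1.eval 1 (C l), Q.1.b + Q.1.c * C l, Q.1.c⟩ :=
    BinForm.SLEquiv.of_entries 1 (C l) 0 1 (by ring) rfl (by simp)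
      (by simp [BinForm.eval])
  exact ⟨⟨_, hS.disc_eq.trans Q.2.1, isPositive_eval hneg hodd Q (Or.inl one_ne_zero)⟩, hS, hl⟩

/-- Representatives of two classes with coprime first coefficients and equal middle
coefficient. -/
theorem exists_united [CharZero k] {D : k[X]} (hneg : IsNegative D)
    (hD : Squarefree D) (hodd : Odd D.natDegree) (Q Q' : FormsOfDisc D) :
    ∃ (a a' e f : k[X]) (_ : (⟨a, e, a' * f⟩ : BinForm k[X]) ∈ FormsOfDisc D)
      (_ : (⟨a', e, a * f⟩ : BinForm k[X]) ∈ FormsOfDisc D),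
      BinForm.SLEquiv Q.1 ⟨a, e, a' * f⟩ ∧ BinForm.SLEquiv Q'.1 ⟨a', e, a * f⟩ ∧
        IsCoprime a D ∧ IsCoprime a' D := by
  obtain ⟨⟨⟨a, b, c⟩, hdisc, hpos⟩, hS, hc⟩ :=
    exists_slEquiv_isCoprime hneg hD hodd Q D hD.ne_zero
  obtain ⟨⟨⟨a', b', c'⟩, hdisc', hpos'⟩, hS', hc'⟩ :=
    exists_slEquiv_isCoprime hneg hD hodd Q' (a * D) (mul_ne_zero hpos.ne_zero hD.ne_zero)
  simp only [BinForm.disc] at hdisc hdisc' hpos hpos' hS hS' hc hc'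
  have ha : a ≠ 0 := hpos.ne_zero
  have ha' : a' ≠ 0 := hpos'.ne_zero
  have hcop : IsCoprime a a' := hc'.of_mul_right_left.symm
  obtain ⟨u, v, huv⟩ := hcop
  -- Chinese remainder: `e ≡ b` modulo `a` and `e ≡ b'` modulo `a'`. Then `a` and `a'` both divide
  -- `e² - D`, and being coprime so does `aa'`; the quotient is `f`.
  obtain ⟨e, s, s', he, he'⟩ : ∃ e s s', e = b + a * s ∧ e = b' + a' * s' :=
    ⟨b + a * (u * (b' - b)), u * (b' - b), (b - b') * v, rfl, by
      linear_combination (b' - b) * huv⟩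
  have h1 : a ∣ e ^ 2 - D := ⟨c + 2 * b * s + a * s ^ 2, by rw [he, ← hdisc]; ring⟩
  have h2 : a' ∣ e ^ 2 - D := ⟨c' + 2 * b' * s' + a' * s' ^ 2, by rw [he', ← hdisc']; ring⟩
  obtain ⟨f, hf⟩ := IsCoprime.mul_dvd ⟨u, v, huv⟩ h1 h2
  have e1 : c + 2 * b * s + a * s ^ 2 = a' * f := mul_left_cancel₀ ha (by
    rw [← mul_assoc, ← hf, he, ← hdisc]; ring)
  have e2 : c' + 2 * b' * s' + a' * s' ^ 2 = a * f := mul_left_cancel₀ ha' (by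
    rw [← mul_assoc, mul_comm a' a, ← hf, he', ← hdisc']; ring)
  refine ⟨a, a', e, f, ⟨?_, hpos⟩, ⟨?_, hpos'⟩, ?_, ?_, hc, hc'.of_mul_right_right⟩
  · simp only [BinForm.disc]
    linear_combination hf
  · simp only [BinForm.disc]
    linear_combination hf
  · have := hS.trans (BinForm.SLEquiv.translate _ s)
    rwa [e1, ← he] at this
  · have := hS'.trans (BinForm.SLEquiv.translate _ s')
    rwa [e2, ← he'] at this

/-! ### Transitivity of composition -/

theorem mk_eq_mk {D : k[X]} {Q Q' : FormsOfDisc D} (h : BinForm.SLEquiv Q.1 Q'.1) :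
    FormClass.mk Q = FormClass.mk Q' := Quotient.sound h

/-- A common divisor of `a`, `m` and `2e` has its square dividing `e² - amf = D`. -/
theorem concordant_of_squarefree {D a m e f : k[X]} (hD : Squarefree D)
    (h : e ^ 2 - a * m * f = D) (hu : IsUnit (2 : k[X])) :
    Concordant ⟨a, e, m * f⟩ ⟨m, e, a * f⟩ := by
  intro d ha hm he
  have he' : d ∣ e := by
    rw [show e + e = 2 * e by ring] at he
    exact hu.dvd_mul_left.1 he
  refine hD d ?_
  rw [← h, pow_two]
  exact dvd_sub (mul_dvd_mul he' he') ((mul_dvd_mul ha hm).mul_right f)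

/-- Division of classes: every class is the composition of a given class with some class. -/
theorem exists_isComposition [CharZero k] {D : k[X]} (hneg : IsNegative D)
    (hD : Squarefree D) (hodd : Odd D.natDegree) (Q Q' : FormsOfDisc D) :
    ∃ P : FormClass D, IsComposition (FormClass.mk Q) P (FormClass.mk Q') := by
  obtain ⟨a, a', e, f, h, h', hS, hS', -, hc'⟩ := exists_united hneg hD hodd Q Q'
  have hdisc : e ^ 2 - a * (a' * f) = D := h.1
  -- The vector `(-2e, a')` is the reflection of `a'(0, 1)`, so `(a', e, af)` takes the value `a ·
  -- fa'²` there. Using `(0, 1)` itself would give middle coefficient `-e`; the reflection restores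
  -- the sign, so that it is `≡ e` modulo `a`. Primitivity holds because `a'` is prime to `D`, hence
  -- to `e`.
  have hcop : IsCoprime (-2 * e) a' := by
    have h1 : IsCoprime (e ^ 2) a' := by
      have : e ^ 2 = D + a' * (a * f) := by rw [← hdisc]; ring
      rw [this]
      exact hc'.symm.add_mul_left_left _
    have h2 : IsCoprime e a' := (IsCoprime.pow_left_iff two_pos).1 h1
    have h3 : IsUnit (-2 : k[X]) := isUnit_two.neg
    exact (isCoprime_mul_unit_left_left h3 e a').2 h2
  obtain ⟨w, z, hwz⟩ := hcop
  -- In the basis `(-2e, a')`, `(-z, w)` the second form becomes `(a · fa'², E, F)`. Translating the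
  -- first form to middle coefficient `E` exhibits the quotient class as that of `(fa'², E, aF)`.
  set E := e + a * (f * a' * w) with hE
  set F := (⟨a', e, a * f⟩ : BinForm k[X]).eval (-z) w with hF
  have hFz : F = z + a * f * w ^ 2 := by
    rw [hF]
    simp only [BinForm.eval]
    linear_combination z * hwz
  have hEF : E ^ 2 - a * (f * a' ^ 2) * F = D := by
    rw [hE, hFz, ← hdisc]
    linear_combination -a * f * a' * hwz
  have h1 : BinForm.SLEquiv Q.1 ⟨a, E, f * a' ^ 2 * F⟩ := by
    have := hS.trans (BinForm.SLEquiv.translate _ (f * a' * w))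
    convert this using 2
    rw [hFz]
    linear_combination f * a' * hwz
  have h2 : BinForm.SLEquiv Q'.1 ⟨a * (f * a' ^ 2), E, F⟩ := by
    refine hS'.trans (BinForm.SLEquiv.of_entries (-2 * e) a' (-z) w ?_ ?_ ?_ rfl)
    · linear_combination hwz
    · simp only [BinForm.eval]; ring
    · simp only [hE]
      linear_combination -e * hwz
  have hp2 : IsPositive (a * (f * a' ^ 2)) := by
    have := isPositive_eval hneg hodd ⟨_, h'⟩ (x := -2 * e) (y := a') (Or.inr h'.2.ne_zero)
    convert this using 1
    simp only [BinForm.eval]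
    ring
  have hm1 : (⟨a, E, f * a' ^ 2 * F⟩ : BinForm k[X]) ∈ FormsOfDisc D :=
    ⟨by rw [← hEF]; simp only [BinForm.disc]; ring, h.2⟩
  have hm2 : (⟨a * (f * a' ^ 2), E, F⟩ : BinForm k[X]) ∈ FormsOfDisc D := ⟨hEF, hp2⟩
  have hm3 : (⟨f * a' ^ 2, E, a * F⟩ : BinForm k[X]) ∈ FormsOfDisc D :=
    ⟨by rw [← hEF]; simp only [BinForm.disc]; ring, IsPositive.of_mul h.2 hp2⟩
  exact ⟨_, a, f * a' ^ 2, E, F, hm1, hm3, hm2, concordant_of_squarefree hD hEF isUnit_two,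
    (mk_eq_mk (Q' := ⟨_, hm1⟩) h1).symm, rfl, (mk_eq_mk (Q' := ⟨_, hm2⟩) h2).symm⟩

theorem sameGenus_of_genusChar_eq [CharZero k] {D : k[X]} (hneg : IsNegative D)
    (hD : Squarefree D) (hodd : Odd D.natDegree) {Q Q' : FormsOfDisc D}
    (h : ∀ p : k[X], p.Monic → Irreducible p → p ∣ D → genusChar p Q = genusChar p Q') :
    SameGenus Q Q' := by
  -- The common genus is the coset of `[Q]`. That it contains `[Q]` itself also comes from division
  -- of classes, with no appeal to an identity class.
  have key : ∀ Q'' : FormsOfDisc D,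
      (∀ p : k[X], p.Monic → Irreducible p → p ∣ D → genusChar p Q = genusChar p Q'') →
      ∃ P ∈ principalGenus D, IsComposition (FormClass.mk Q) P (FormClass.mk Q'') := by
    intro Q'' h
    obtain ⟨P, hP⟩ := exists_isComposition hneg hD hodd Q Q''
    refine ⟨P, fun p hm hp hpD => ?_, hP⟩
    have h1 : genusChar p Q'' = genusChar p Q * classChar p P := classChar_mul hD hp hpD hP
    rw [← h p hm hp hpD] at h1
    let _ : Group (SquareClass p) := QuotientGroup.Quotient.group _
    exact left_eq_mul.1 h1
  exact ⟨_, ⟨FormClass.mk Q, rfl⟩, key Q fun _ _ _ _ => rfl, key Q' h⟩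

/-! ### Characters and rational equivalence -/

/-- A square modulo all primes dividing a square-free `D` is a square modulo `D`. -/
theorem exists_dvd_sub_sq {D n : k[X]} (hD : Squarefree D)
    (h : ∀ p, Irreducible p → p ∣ D → ∃ s, p ∣ n - s ^ 2) : ∃ s, D ∣ n - s ^ 2 := by
  induction D using UniqueFactorizationMonoid.induction_on_prime with
  | h₁ => exact absurd rfl hD.ne_zero
  | h₂ N hu => exact ⟨0, hu.dvd⟩
  | h₃ N p hN' hp ih =>
    obtain ⟨s, hs⟩ := ih (hD.squarefree_of_dvd (dvd_mul_left N p))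
      fun q hq hqN => h q hq (hqN.mul_left p)
    obtain ⟨r, hr⟩ := h p hp.irreducible (dvd_mul_right p N)
    have hpN : ¬ p ∣ N := fun hpN => hp.not_isUnit (hD p (mul_dvd_mul_left p hpN))
    have hcop := isCoprime_of_not_dvd hp.irreducible hpN
    obtain ⟨u, v, huv⟩ := id hcop
    -- With `uN + vp = 1`, this is the Chinese remainder solution congruent to `r` modulo `p` and to
    -- `s` modulo `N`.
    refine ⟨s + u * N * (r - s), hcop.symm.mul_dvd ?_ ?_⟩
    · have : n - (s + u * N * (r - s)) ^ 2 = (n - r ^ 2) + p * (v * (r - s) *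
          (r + (s + u * N * (r - s)))) := by
        linear_combination -(r - s) * (r + (s + u * N * (r - s))) * huv
      rw [this]
      exact dvd_add hr (dvd_mul_right _ _)
    · have : n - (s + u * N * (r - s)) ^ 2 = (n - s ^ 2) - N * (u * (r - s) *
          (2 * s + u * N * (r - s))) := by ring
      rw [this]
      exact dvd_sub hs (dvd_mul_right _ _)

/-! ### Legendre's theorem by a dimension count. -/

theorem natDegree_mul_sq_lt {a Z : k[X]} {m N : ℕ} (hZ : Z ∈ degreeLT k m)
    (h : a.natDegree + 2 * m < N + 2) (hN : 0 < N) : (a * Z ^ 2).natDegree < N := by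
  -- The zero polynomial has `natDegree` 0, which is why `0 < N` is required.
  by_cases h0 : Z = 0
  · simpa [h0] using hN
  rw [mem_degreeLT, degree_eq_natDegree h0] at hZ
  have hZ : Z.natDegree < m := by exact_mod_cast hZ
  have h1 := natDegree_mul_le (p := a) (q := Z ^ 2)
  rw [natDegree_pow] at h1
  omega

/-- Legendre's theorem over `k[t]`, when `D` has odd degree. -/
theorem exists_norm_eq {D n e s : k[X]} (hodd : Odd D.natDegree) (hn : n ≠ 0)
    (hcop : IsCoprime n D) (he : n ∣ D - e ^ 2) (hs : D ∣ n - s ^ 2) :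
    ∃ X Y Z : k[X], Z ≠ 0 ∧ X ^ 2 - D * Y ^ 2 = n * Z ^ 2 := by
  have hD : D ≠ 0 := by rintro rfl; simp at hodd
  set m := n.natDegree with hm
  set d := D.natDegree with hd
  -- Unknowns `X`, `Y`, `Z` have degrees below `⌈(m+d)/2⌉`, `⌈m/2⌉`, `⌈d/2⌉`. For odd `d` these add
  -- up to `m + d + 1`, one more than the `m + d` conditions `X ≡ eY` modulo `n` and `X ≡ sZ` modulo
  -- `D`.
  let V := degreeLT k ((m + d + 1) / 2) × degreeLT k ((m + 1) / 2) × degreeLT k ((d + 1) / 2)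
  let W := AdjoinRoot n × AdjoinRoot D
  have : Module.Finite k (AdjoinRoot n) := (AdjoinRoot.powerBasis hn).finite
  have : Module.Finite k (AdjoinRoot D) := (AdjoinRoot.powerBasis hD).finite
  have hfin : ∀ j, Module.Finite k (degreeLT k j) := fun j =>
    Module.Finite.equiv (degreeLTEquiv k j).symm
  have hrank : ∀ j, Module.finrank k (degreeLT k j) = j := fun j => by
    rw [(degreeLTEquiv k j).finrank_eq, Module.finrank_fin_fun]
  let x : V →ₗ[k] k[X] := Submodule.subtype _ ∘ₗ LinearMap.fst k _ _
  let y : V →ₗ[k] k[X] := Submodule.subtype _ ∘ₗ LinearMap.fst k _ _ ∘ₗ LinearMap.snd k _ _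
  let z : V →ₗ[k] k[X] := Submodule.subtype _ ∘ₗ LinearMap.snd k _ _ ∘ₗ LinearMap.snd k _ _
  let f : V →ₗ[k] W :=
    ((AdjoinRoot.mkₐ n).toLinearMap ∘ₗ (x - LinearMap.mulLeft k e ∘ₗ y)).prod
      ((AdjoinRoot.mkₐ D).toLinearMap ∘ₗ (x - LinearMap.mulLeft k s ∘ₗ z))
  have hlt : Module.finrank k W < Module.finrank k V := by
    rw [Module.finrank_prod, Module.finrank_prod, Module.finrank_prod, hrank, hrank, hrank,
      (AdjoinRoot.powerBasis hn).finrank, (AdjoinRoot.powerBasis hD).finrank,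
      AdjoinRoot.powerBasis_dim, AdjoinRoot.powerBasis_dim]
    obtain ⟨j, hj⟩ := hodd
    omega
  obtain ⟨⟨⟨X, hX⟩, ⟨Y, hY⟩, ⟨Z, hZ⟩⟩, hv, hv0⟩ :=
    (Submodule.ne_bot_iff _).1 (LinearMap.ker_ne_bot_of_finrank_lt hlt (f := f))
  have h1 : n ∣ X - e * Y := AdjoinRoot.mk_eq_zero.1 (congrArg Prod.fst hv)
  have h2 : D ∣ X - s * Z := AdjoinRoot.mk_eq_zero.1 (congrArg Prod.snd hv)
  have hdvd : n * D ∣ X ^ 2 - D * Y ^ 2 - n * Z ^ 2 := by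
    refine hcop.mul_dvd ?_ ?_
    · have : X ^ 2 - D * Y ^ 2 - n * Z ^ 2 = (X - e * Y) * (X + e * Y) - (D - e ^ 2) * Y ^ 2
        - n * Z ^ 2 := by ring
      rw [this]
      exact dvd_sub (dvd_sub (h1.mul_right _) (he.mul_right _)) (dvd_mul_right _ _)
    · have : X ^ 2 - D * Y ^ 2 - n * Z ^ 2 = (X - s * Z) * (X + s * Z) - (n - s ^ 2) * Z ^ 2
        - D * Y ^ 2 := by ring
      rw [this]
      exact dvd_sub (dvd_sub (h2.mul_right _) (hs.mul_right _)) (dvd_mul_right _ _)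
  -- Each of the three terms has degree below `m + d = deg(nD)`, so a multiple of `nD` must vanish.
  have hzero : X ^ 2 - D * Y ^ 2 - n * Z ^ 2 = 0 := by
    by_contra hne
    have h3 := natDegree_le_of_dvd hdvd hne
    rw [natDegree_mul hn hD, ← hm, ← hd] at h3
    obtain ⟨j, hj⟩ := hodd
    have h4 := natDegree_mul_sq_lt (a := 1) (N := m + d) hX (by simp; omega) (by omega)
    have h5 := natDegree_mul_sq_lt (a := D) (N := m + d) hY (by omega) (by omega)
    have h6 := natDegree_mul_sq_lt (a := n) (N := m + d) hZ (by omega) (by omega)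
    rw [one_mul] at h4
    have h7 := natDegree_sub_le (X ^ 2 - D * Y ^ 2) (n * Z ^ 2)
    have h8 := natDegree_sub_le (X ^ 2) (D * Y ^ 2)
    omega
  refine ⟨X, Y, Z, ?_, sub_eq_zero.1 hzero⟩
  rintro rfl
  -- If `Z = 0`, parity of degrees forces `X = Y = 0`, contradicting the choice of a nonzero kernel
  -- vector.
  have h9 : X ^ 2 = D * Y ^ 2 := by linear_combination hzero
  have hY0 : Y = 0 := by
    by_contra hY0
    have hX0 : X ≠ 0 := by
      rintro rfl
      simp [hD, hY0] at h9
    have := natDegree_sq_lt_or hodd hX0 hY0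
    rw [h9] at this
    simp at this
  subst hY0
  have hX0 : X = 0 := by simpa using h9
  subst hX0
  exact hv0 rfl

/-! ### Equivalence over `k(t)`. -/

namespace RationallyEquiv

theorem trans {Q Q' Q'' : BinForm k[X]} (h : RationallyEquiv Q Q')
    (h' : RationallyEquiv Q' Q'') : RationallyEquiv Q Q'' := by
  obtain ⟨M, hM⟩ := h
  obtain ⟨N, hN⟩ := h'
  refine ⟨N * M, ?_⟩
  rw [hN, hM, Units.val_mul, Matrix.transpose_mul]
  simp only [Matrix.mul_assoc]

theorem of_slEquiv {Q Q' : BinForm k[X]} (h : BinForm.SLEquiv Q Q') : RationallyEquiv Q Q' := by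
  obtain ⟨M, hM⟩ := h
  refine ⟨(Matrix.SpecialLinearGroup.map (algebraMap k[X] (RatFunc k)) M :
    Matrix.SpecialLinearGroup (Fin 2) (RatFunc k)), ?_⟩
  rw [hM, Matrix.map_mul, Matrix.map_mul, Matrix.transpose_map]
  rfl

/-- Forms with the same discriminant are equivalent over `k(t)` as soon as one represents the
first coefficient of the other over `k(t)`. -/
theorem of_represents {Q Q' : BinForm k[X]} (hdisc : Q.disc = Q'.disc) (ha : Q'.a ≠ 0)
    {d x y : k[X]} (hd : d ≠ 0) (h : Q.eval x y = Q'.a * d ^ 2) : RationallyEquiv Q Q' := by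
  have hd' : algebraMap k[X] (RatFunc k) d ≠ 0 := RatFunc.algebraMap_ne_zero hd
  have ha' : algebraMap k[X] (RatFunc k) Q'.a ≠ 0 := RatFunc.algebraMap_ne_zero ha
  have h1 := congrArg (algebraMap k[X] (RatFunc k)) h
  have h2 := congrArg (algebraMap k[X] (RatFunc k)) hdisc
  simp only [BinForm.eval, BinForm.disc, map_add, map_sub, map_mul, map_pow, map_ofNat] at h1 h2
  obtain ⟨a, b, c⟩ := Q
  obtain ⟨a', b', c'⟩ := Q'
  simp only at h1 h2 ha'
  generalize algebraMap k[X] (RatFunc k) d = d at *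
  set φ := algebraMap k[X] (RatFunc k)
  have h0 : ∃ x' y' : RatFunc k, φ a * x' ^ 2 + 2 * φ b * x' * y' + φ c * y' ^ 2 = φ a' := by
    refine ⟨φ x / d, φ y / d, ?_⟩
    field_simp
    linear_combination h1
  clear h1
  obtain ⟨x, y, h1⟩ := h0
  -- Cramer's rule for the second basis vector `(z, w)`: determinant 1 with `(x, y)`, and bilinear
  -- pairing `b'` with it. The system has determinant `Q(x, y) = a'`. The last coefficient is then
  -- forced by the discriminant.
  set z := (-(φ b * x + φ c * y) + φ b' * x) / φ a' with hz
  set w := (φ a * x + φ b * y + φ b' * y) / φ a' with hw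
  have hz' : φ a' * z = -(φ b * x + φ c * y) + φ b' * x := by rw [hz]; field_simp
  have hw' : φ a' * w = φ a * x + φ b * y + φ b' * y := by rw [hw]; field_simp
  have hdet : x * w - y * z = 1 := mul_left_cancel₀ ha' (by
    linear_combination x * hw' - y * hz' + h1)
  have hb : φ a * x * z + φ b * (x * w + y * z) + φ c * y * w = φ b' := mul_left_cancel₀ ha' (by
    linear_combination (φ a * x + φ b * y) * hz' + (φ b * x + φ c * y) * hw' + φ b' * h1)
  have hc : φ a * z ^ 2 + 2 * φ b * z * w + φ c * w ^ 2 = φ c' := mul_left_cancel₀ ha' (by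
    have h3 : (φ a * x * z + φ b * (x * w + y * z) + φ c * y * w) ^ 2 -
      (φ a * x ^ 2 + 2 * φ b * x * y + φ c * y ^ 2) *
        (φ a * z ^ 2 + 2 * φ b * z * w + φ c * w ^ 2) =
      (φ b ^ 2 - φ a * φ c) * (x * w - y * z) ^ 2 := by ring
    rw [hb, h1, hdet] at h3
    linear_combination -h3 - h2)
  refine ⟨Matrix.GeneralLinearGroup.mkOfDetNeZero !![x, y; z, w] (by
    rw [Matrix.det_fin_two_of, hdet]; exact one_ne_zero), ?_⟩
  change _ = !![x, y; z, w] * _ * (!![x, y; z, w]).transpose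
  rw [← Matrix.ext_iff]
  simp only [BinForm.toMatrix, Matrix.mul_apply, Fin.sum_univ_two, Matrix.transpose_apply,
    Matrix.map_apply, Matrix.of_apply, Matrix.cons_val', Matrix.cons_val_zero,
    Matrix.cons_val_one, Matrix.cons_val_fin_one, Fin.forall_fin_two]
  refine ⟨⟨?_, ?_⟩, ?_, ?_⟩
  · linear_combination -h1
  · linear_combination -hb
  · linear_combination -hb
  · linear_combination -hc

/-- Clearing the denominators of `(x, y)M` turns a value `n` of `Q'` into a value `n d²` of `Q`, and
`χ_p` ignores the square. -/
theorem genusChar_eq [CharZero k] {D : k[X]} (hD : Squarefree D) {Q Q' : FormsOfDisc D}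
    (h : RationallyEquiv Q.1 Q'.1) {p : k[X]} (hp : Irreducible p) (hpD : p ∣ D) :
    genusChar p Q = genusChar p Q' := by
  obtain ⟨n, hn, x, y, -, hxy⟩ := exists_properlyRepresents hD hp Q'
  rw [genusChar_eq_of_eval hD hp hpD Q' hn one_ne_zero (by rw [hxy]; ring)]
  obtain ⟨M, hM⟩ := h
  classical
  set φ := algebraMap k[X] (RatFunc k)
  set M' := (M : Matrix (Fin 2) (Fin 2) (RatFunc k))
  obtain ⟨⟨d, hd⟩, hint⟩ := IsLocalization.exist_integer_multiples_of_finset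
    (nonZeroDivisors k[X]) {φ x * M' 0 0 + φ y * M' 1 0, φ x * M' 0 1 + φ y * M' 1 1}
  obtain ⟨z, hz⟩ := hint (φ x * M' 0 0 + φ y * M' 1 0) (by simp)
  obtain ⟨w, hw⟩ := hint (φ x * M' 0 1 + φ y * M' 1 1) (by simp)
  simp only [Algebra.smul_def] at hz hw
  refine genusChar_eq_of_eval (x := z) (y := w) hD hp hpD Q hn (nonZeroDivisors.ne_zero hd) ?_
  apply RatFunc.algebraMap_injective k
  have e1 := congrFun (congrFun hM 0) 0
  have e2 := congrFun (congrFun hM 0) 1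
  have e3 := congrFun (congrFun hM 1) 1
  simp only [BinForm.toMatrix, Matrix.mul_apply, Fin.sum_univ_two, Matrix.transpose_apply,
    Matrix.map_apply, Matrix.of_apply, Matrix.cons_val', Matrix.cons_val_zero,
    Matrix.cons_val_one, Matrix.cons_val_fin_one] at e1 e2 e3
  rw [← hxy]
  simp only [BinForm.eval, map_add, map_mul, map_pow, map_ofNat]
  change φ z = φ d * _ at hz
  change φ w = φ d * _ at hw
  change φ Q.1.a * φ z ^ 2 + 2 * φ Q.1.b * φ z * φ w + φ Q.1.c * φ w ^ 2 =
    (φ Q'.1.a * φ x ^ 2 + 2 * φ Q'.1.b * φ x * φ y + φ Q'.1.c * φ y ^ 2) * φ d ^ 2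
  rw [hz, hw, e1, e2, e3]
  ring

end RationallyEquiv

theorem rationallyEquiv_of_genusChar_eq [CharZero k] {D : k[X]} (hneg : IsNegative D)
    (hD : Squarefree D) (hodd : Odd D.natDegree) {Q Q' : FormsOfDisc D}
    (h : ∀ p : k[X], p.Monic → Irreducible p → p ∣ D → genusChar p Q = genusChar p Q') :
    RationallyEquiv Q.1 Q'.1 := by
  obtain ⟨a, a', e, f, hm, hm', hS, hS', hc, hc'⟩ := exists_united hneg hD hodd Q Q'
  refine (RationallyEquiv.of_slEquiv hS).trans
    (RationallyEquiv.trans ?_ (RationallyEquiv.of_slEquiv hS'.symm))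
  have hsq : ∀ p, Irreducible p → p ∣ D → ∃ s, p ∣ a * a' - s ^ 2 := by
    classical
    intro q hq hqD
    -- The characters are compared only at monic primes, so `q` is replaced by its monic associate.
    have hass := normalize_associated q
    set p := normalize q with hpdef
    have hp : Irreducible p := hass.symm.irreducible hq
    have hpD : p ∣ D := hass.dvd.trans hqD
    have h1 : IsCoprime a p := hc.of_isCoprime_of_dvd_right hpD
    have h2 : IsCoprime a' p := hc'.of_isCoprime_of_dvd_right hpD
    have e1 := genusChar_eq hD hp hpD Q h1
      (hS.properlyRepresents ⟨1, 0, isCoprime_one_left, by simp [BinForm.eval]⟩)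
    have e2 := genusChar_eq hD hp hpD Q' h2
      (hS'.properlyRepresents ⟨1, 0, isCoprime_one_left, by simp [BinForm.eval]⟩)
    have e3 := h p (monic_normalize hq.ne_zero) hp hpD
    rw [e1, e2, tameSymbol_eq_iff hD hp hpD h1 h2] at e3
    obtain ⟨s, hs⟩ := e3
    exact ⟨s, hass.symm.dvd.trans hs⟩
  obtain ⟨s, hs⟩ := exists_dvd_sub_sq hD hsq
  have ha := hm.2.ne_zero
  have ha' := hm'.2.ne_zero
  simp only at ha ha'
  have hdisc : e ^ 2 - a * (a' * f) = D := hm.1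
  obtain ⟨X, Y, Z, hZ, hXYZ⟩ := exists_norm_eq (e := e) hodd (mul_ne_zero ha ha')
    (hc.mul_left hc') ⟨-f, by rw [← hdisc]; ring⟩ hs
  -- At `(X - eY, aY)` the linear form `ax + ey` equals `aX`. So `a` times the value is `a²(X² -
  -- DY²) = a² · aa'Z²`, and the value is `a'(aZ)²`.
  refine RationallyEquiv.of_represents (hm.1.trans hm'.1.symm) ha' (d := a * Z)
    (x := X - e * Y) (y := a * Y) (mul_ne_zero ha hZ) ?_
  simp only [BinForm.eval]
  rw [← hdisc] at hXYZ
  linear_combination a * hXYZ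

end PolyForm

theorem mainTheorem6 {k : Type*} [Field k] [NumberField k] (D : Polynomial k)
    (hneg : PolyForm.IsNegative D) (hsq : Squarefree D) (hodd : Odd D.natDegree)
    (Q Q' : PolyForm.FormsOfDisc D) :
    PolyForm.SameGenus Q Q' ↔ PolyForm.RationallyEquiv Q.1 Q'.1 :=
  ⟨fun h => PolyForm.rationallyEquiv_of_genusChar_eq hneg hsq hodd (h.genusChar_eq hsq),
    fun h => PolyForm.sameGenus_of_genusChar_eq hneg hsq hodd
      fun _ _ hp hpD => h.genusChar_eq hsq hp hpD⟩
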